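/- Let $(X,\rho)$ be a metric space, and write $|xy|=\rho(x,y)$. A segment with endpoints $x,y\in X$ is a curve joining $x$ and $y$ whose length equals $|xy|$; a line is a curve in $X$ isometric to $\mathbb R$ with its standard metric. Suppose that $X$ is a geodesic space (any two of its points are joined by a segment), that through any two distinct points of $X$ there passes exactly one line, and that $X$ satisfies the global Busemann nonpositive curvature condition $$(A_3)\qquad 2\,|\omega(z,x)\,\omega(z,y)|\le |xy|\qquad\text{for all } x,y,z\in X,$$ where $\omega(x,y)$ denotes the midpoint of $x$ and $y$ (it exists and is unique under the preceding hypotheses). For nonempty bounded sets $A,B\subset X$ let $$\alpha(A,B)=\max\Bigl\{\sup_{a\in A}\inf_{b\in B}|ab|,\ \sup_{b\in B}\inf_{a\in A}|ab|\Bigr\}$$ be the Hausdorff distance, let $B[x,r]=\{y\in X:|xy|\le r\}$ for $x\in X$, $r\ge 0$, and for a nonempty bounded set $M\subset X$ put $$\chi(M)=\Bigl\{x\in X:\ \alpha(B[x,r],M)=\inf\{\alpha(M,B[y,t]):y\in X,\ t\ge 0\}\ \text{ for some } r\ge 0\Bigr\},$$ the set of centers of the closed balls that best approximate $M$ in the Hausdorff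 metric. Let $M\subset X$ be a nonempty compact set that is convex, i.e. contains every segment whose endpoints lie in $M$. Then $$\chi(M)\neq\emptyset\quad\text{and}\quad \chi(M)\subset M .$$ -/

import Mathlib

namespace BallApprox

variable {X : Type*} [MetricSpace X]

/-- `S` is a segment with endpoints `x` and `y`: a curve joining `x` to `y` whose length is the
distance from `x` to `y`. Parametrized by arc length, it is an isometric image of
`[0, dist x y]`. -/
def IsSegment (S : Set X) (x y : X) : Prop :=
  ∃ γ : ℝ → X,
    (∀ s ∈ Set.Icc 0 (dist x y), ∀ t ∈ Set.Icc 0 (dist x y), dist (γ s) (γ t) = |s - t|) ∧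
    γ 0 = x ∧ γ (dist x y) = y ∧ S = γ '' Set.Icc 0 (dist x y)

/-- `L` is a line: a curve isometric to the real line with its standard metric. -/
def IsLine (L : Set X) : Prop :=
  ∃ γ : ℝ → X, Isometry γ ∧ L = Set.range γ

/-- `m` is a midpoint of `x` and `y`. -/
def IsMidpoint (m x y : X) : Prop :=
  2 * max (dist x m) (dist m y) ≤ dist x y

variable (X) in
/-- `X` is a geodesic space: any two points are joined by a segment. -/
def IsGeodesicSpace : Prop :=
  ∀ x y : X, ∃ S : Set X, IsSegment S x y

variable (X) in
/-- Through any two distinct points of `X` there passes exactly one line. -/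
def HasUniqueLines : Prop :=
  ∀ x y : X, x ≠ y → ∃! L : Set X, IsLine L ∧ x ∈ L ∧ y ∈ L

variable (X) in
/-- The global Busemann nonpositive curvature condition: in every triangle `x y z`, the distance
between the midpoints of the sides `[z, x]` and `[z, y]` is at most half of the third side. -/
def IsBusemannNonpositivelyCurved : Prop :=
  ∀ x y z m n : X, IsMidpoint m z x → IsMidpoint n z y → 2 * dist m n ≤ dist x y

/-- `M` is convex: it contains every segment whose endpoints lie in `M`. -/
def IsConvex (M : Set X) : Prop :=
  ∀ x ∈ M, ∀ y ∈ M, ∀ S : Set X, IsSegment S x y → S ⊆ M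

/-- The Hausdorff distance from `M` to the family of all closed balls (of radius `t ≥ 0`). -/
noncomputable def distToBalls (M : Set X) : ℝ :=
  sInf {d : ℝ | ∃ (y : X) (t : ℝ), 0 ≤ t ∧ d = Metric.hausdorffDist M (Metric.closedBall y t)}

/-- `χ(M)`: the centers of the closed balls that best approximate `M` in the Hausdorff metric. -/
def bestBallCenters (M : Set X) : Set X :=
  {x : X | ∃ r : ℝ, 0 ≤ r ∧ Metric.hausdorffDist (Metric.closedBall x r) M = distToBalls M}

end BallApprox

namespace BallApprox

/-! Take a ball B[x,r] with x outside M, p the point of M nearest to x, s = |px|, and m the point of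
M farthest from p. Extend [p,x] to a ray. By the Busemann condition the distance to M along it stays
equal to the distance to p, so the ball has a point at distance s + r from M. Also m is at distance
at least |xm| - r from the ball. Averaging, the Hausdorff distance is at least (s + |xm|)/2, which
exceeds |pm|/2: equality would put x on a segment [p,m], hence in M. But B[p,|pm|/2] has error at
most |pm|/2, so no outside center is optimal. Existence then reduces to centers in M and radii at
most diam M, where compactness and continuity of the error give a minimum. -/

/-- In a geodesic space, every point `b` is within `max 0 (dist y b - t)` of the closed ball of
radius `t ≥ 0` around `y`. -/
theorem IsGeodesicSpace.exists_mem_closedBall_dist_le {X : Type*} [MetricSpace X]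
    (hgeod : IsGeodesicSpace X) (y b : X) {t : ℝ} (ht : 0 ≤ t) :
    ∃ c ∈ Metric.closedBall y t, dist b c ≤ max 0 (dist y b - t) := by
  rcases le_total (dist y b) t with h | h
  · exact ⟨b, by simpa [dist_comm] using h, by simp⟩
  · obtain ⟨_, γ, hγ, h0, h1, -⟩ := hgeod y b
    refine ⟨γ t, ?_, ?_⟩
    · rw [Metric.mem_closedBall, ← h0, hγ t ⟨ht, h⟩ 0 ⟨le_rfl, dist_nonneg⟩, sub_zero,
        abs_of_nonneg ht]
    · have := hγ (dist y b) ⟨dist_nonneg, le_rfl⟩ t ⟨ht, h⟩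
      rw [h1, abs_of_nonneg (sub_nonneg.2 h)] at this
      exact this.le.trans (le_max_right _ _)

/-- The real-valued `hausdorffDist` is 0 when the extended one is infinite, so every lower bound on
it needs this finiteness. -/
theorem hausdorffEDist_closedBall_ne_top {X : Type*} [MetricSpace X] {M : Set X}
    (hne : M.Nonempty) (hM : Bornology.IsBounded M) (x : X) {r : ℝ} (hr : 0 ≤ r) :
    Metric.hausdorffEDist M (Metric.closedBall x r) ≠ ⊤ :=
  Metric.hausdorffEDist_ne_top_of_nonempty_of_bounded hne
    (Metric.nonempty_closedBall.2 hr) hM Metric.isBounded_closedBall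

/-- In a geodesic space, closed balls depend on their center and radius in a `1`-Lipschitz way. -/
theorem IsGeodesicSpace.hausdorffDist_closedBall_le {X : Type*} [MetricSpace X]
    (hgeod : IsGeodesicSpace X) (x y : X) {r t : ℝ} (hr : 0 ≤ r) (ht : 0 ≤ t) :
    Metric.hausdorffDist (Metric.closedBall x r) (Metric.closedBall y t)
      ≤ dist x y + |r - t| := by
  have key : ∀ (x y : X) (r t : ℝ), 0 ≤ t → ∀ b ∈ Metric.closedBall x r,
      ∃ c ∈ Metric.closedBall y t, dist b c ≤ dist x y + |r - t| := by
    intro x y r t ht b hb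
    obtain ⟨c, hc, hbc⟩ := hgeod.exists_mem_closedBall_dist_le y b ht
    refine ⟨c, hc, hbc.trans (max_le (by positivity) ?_)⟩
    have := dist_triangle_left y b x
    have := Metric.mem_closedBall'.1 hb
    linarith [le_abs_self (r - t)]
  refine Metric.hausdorffDist_le_of_mem_dist (by positivity) (key x y r t ht) ?_
  intro b hb
  simpa only [dist_comm y x, abs_sub_comm t r] using key y x t r hr b hb

/-! ### Segments, midpoints and rays -/

/-- A point realizing equality in the triangle inequality lies on a segment. -/
theorem IsGeodesicSpace.exists_isSegment_mem {X : Type*} [MetricSpace X]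
    (hgeod : IsGeodesicSpace X) {p x m : X} (h : dist p x + dist x m = dist p m) :
    ∃ S, IsSegment S p m ∧ x ∈ S := by
  obtain ⟨_, γ, hγ, hγ0, hγ1, -⟩ := hgeod p x
  obtain ⟨_, δ, hδ, hδ0, hδ1, -⟩ := hgeod x m
  set a := dist p x with ha
  have ha0 : 0 ≤ a := dist_nonneg
  have hb0 : 0 ≤ dist x m := dist_nonneg
  -- Concatenation of [p,x] and [x,m].
  set η : ℝ → X := fun s => if s ≤ a then γ s else δ (s - a) with hη
  have η0 : η 0 = p := by simp [hη, ha0, hγ0]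
  have η1 : η (dist p m) = m := by
    by_cases hm : dist p m ≤ a
    · have : dist x m = 0 := by linarith
      have hxm := dist_eq_zero.1 this
      have : dist p m = a := by linarith
      simp [hη, this, hγ1, hxm]
    · have : dist p m - a = dist x m := by linarith
      simp [hη, hm, this, hδ1]
  have ηx : η a = x := by simp [hη, hγ1]
  have short : ∀ s ∈ Set.Icc 0 (dist p m), ∀ t ∈ Set.Icc 0 (dist p m), s ≤ t →
      dist (η s) (η t) ≤ t - s := by
    intro s hs t ht hst
    by_cases h1 : t ≤ a
    · have h2 := hst.trans h1
      simp only [hη, if_pos h1, if_pos h2]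
      rw [hγ s ⟨hs.1, h2⟩ t ⟨ht.1, h1⟩, abs_sub_comm, abs_of_nonneg (by linarith)]
    · have h1' := le_of_not_ge h1
      have htm : t - a ∈ Set.Icc 0 (dist x m) := ⟨by linarith, by linarith [ht.2]⟩
      by_cases h2 : s ≤ a
      · simp only [hη, if_neg h1, if_pos h2]
        have e1 := hγ s ⟨hs.1, h2⟩ a ⟨ha0, le_rfl⟩
        have e2 := hδ 0 ⟨le_rfl, hb0⟩ (t - a) htm
        rw [hγ1, abs_sub_comm, abs_of_nonneg (by linarith)] at e1
        rw [hδ0, abs_sub_comm, abs_of_nonneg (by linarith)] at e2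
        linarith [dist_triangle (γ s) x (δ (t - a))]
      · simp only [hη, if_neg h1, if_neg h2]
        rw [hδ (s - a) ⟨by linarith, by linarith [hs.2]⟩ (t - a) htm, abs_sub_comm,
          abs_of_nonneg (by linarith)]
        linarith
  have isom : ∀ s ∈ Set.Icc 0 (dist p m), ∀ t ∈ Set.Icc 0 (dist p m), s ≤ t →
      dist (η s) (η t) = t - s := by
    intro s hs t ht hst
    -- The whole curve has length at most |pm| and joins p to m, so no piece of it can be shortened.
    refine le_antisymm (short s hs t ht hst) ?_
    have e1 := short 0 ⟨le_rfl, dist_nonneg⟩ s hs hs.1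
    have e2 := short t ht (dist p m) ⟨dist_nonneg, le_rfl⟩ ht.2
    rw [η0] at e1
    rw [η1] at e2
    linarith [dist_triangle4 p (η s) (η t) m]
  refine ⟨η '' Set.Icc 0 (dist p m), ⟨η, ?_, η0, η1, rfl⟩, a, ⟨ha0, by linarith⟩, ηx⟩
  intro s hs t ht
  rcases le_total s t with hst | hst
  · rw [isom s hs t ht hst, abs_sub_comm, abs_of_nonneg (by linarith)]
  · rw [dist_comm, isom t ht s hs hst, abs_of_nonneg (by linarith)]

theorem IsConvex.mem_of_dist_add_dist_eq {X : Type*} [MetricSpace X] {M : Set X}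
    (hconv : IsConvex M) (hgeod : IsGeodesicSpace X) {p x m : X} (hp : p ∈ M) (hm : m ∈ M)
    (h : dist p x + dist x m = dist p m) : x ∈ M :=
  let ⟨S, hS, hxS⟩ := hgeod.exists_isSegment_mem h
  hconv p hp m hm S hS hxS

theorem IsConvex.exists_isMidpoint_mem {X : Type*} [MetricSpace X] {M : Set X}
    (hconv : IsConvex M) (hgeod : IsGeodesicSpace X) {p q : X} (hp : p ∈ M) (hq : q ∈ M) :
    ∃ n ∈ M, IsMidpoint n p q := by
  obtain ⟨S, hS⟩ := hgeod p q
  have hSM := hconv p hp q hq S hS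
  obtain ⟨γ, hγ, h0, h1, rfl⟩ := hS
  have hd : 0 ≤ dist p q := dist_nonneg
  have hmid : dist p q / 2 ∈ Set.Icc 0 (dist p q) := ⟨by linarith, by linarith⟩
  refine ⟨γ (dist p q / 2), hSM ⟨_, hmid, rfl⟩, ?_⟩
  have e1 := hγ 0 ⟨le_rfl, hd⟩ _ hmid
  have e2 := hγ _ hmid _ ⟨hd, le_rfl⟩
  rw [h0, abs_sub_comm, abs_of_nonneg (by linarith)] at e1
  rw [h1, abs_sub_comm, abs_of_nonneg (by linarith)] at e2
  have : max (dist p (γ (dist p q / 2))) (dist (γ (dist p q / 2)) q) ≤ dist p q / 2 :=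
    max_le (by linarith) (by linarith)
  unfold IsMidpoint
  linarith

theorem HasUniqueLines.exists_isometry {X : Type*} [MetricSpace X]
    (hline : HasUniqueLines X) {p x : X} (h : p ≠ x) :
    ∃ γ : ℝ → X, Isometry γ ∧ γ 0 = p ∧ γ (dist p x) = x := by
  obtain ⟨_, ⟨⟨γ, hγ, rfl⟩, ⟨a, rfl⟩, ⟨b, rfl⟩⟩, -⟩ := hline p x h
  rw [hγ.dist_eq, Real.dist_eq]
  rcases le_total a b with hab | hab
  · refine ⟨fun t => γ (a + t), hγ.comp (Isometry.of_dist_eq fun s t => by simp), by simp, ?_⟩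
    simp only
    rw [abs_sub_comm, abs_of_nonneg (by linarith)]
    congr 1; ring
  · refine ⟨fun t => γ (a - t), hγ.comp (Isometry.of_dist_eq fun s t => dist_sub_left a s t), by simp, ?_⟩
    simp only
    rw [abs_of_nonneg (by linarith)]
    congr 1; ring

/-! ### Distance to a convex set along a ray -/

/-- Along a ray issuing from a point of a compact convex set, the distance to the set at least
doubles when the parameter doubles. -/
theorem IsConvex.two_mul_infDist_le {X : Type*} [MetricSpace X] {M : Set X}
    (hconv : IsConvex M) (hgeod : IsGeodesicSpace X) (hcurv : IsBusemannNonpositivelyCurved X)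
    (hcomp : IsCompact M) {γ : ℝ → X} (hγ : Isometry γ) (h0 : γ 0 ∈ M) {t : ℝ} (ht : 0 ≤ t) :
    2 * Metric.infDist (γ t) M ≤ Metric.infDist (γ (2 * t)) M := by
  -- Compare midpoints in the triangle γ 0, γ (2t), q, with q nearest to γ (2t); the midpoint of γ 0
  -- and q lies in M.
  obtain ⟨q, hq, hdq⟩ := hcomp.exists_infDist_eq_dist ⟨_, h0⟩ (γ (2 * t))
  obtain ⟨n, hn, hmid⟩ := hconv.exists_isMidpoint_mem hgeod h0 hq
  have hm : IsMidpoint (γ t) (γ 0) (γ (2 * t)) := by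
    unfold IsMidpoint
    have e1 : |0 - t| = t := by rw [zero_sub, abs_neg, abs_of_nonneg ht]
    have e2 : |t - 2 * t| = t := by rw [abs_sub_comm, abs_of_nonneg] <;> linarith
    have e3 : |0 - 2 * t| = 2 * t := by rw [zero_sub, abs_neg, abs_of_nonneg (by linarith)]
    simp only [hγ.dist_eq, Real.dist_eq, e1, e2, e3, max_self, le_refl]
  rw [hdq]
  have := hcurv _ _ _ _ _ hm hmid
  linarith [Metric.infDist_le_dist_of_mem (x := γ t) hn]

/-- A ray which leaves a compact convex set perpendicularly stays perpendicular to it. -/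
theorem IsConvex.le_infDist_ray {X : Type*} [MetricSpace X] {M : Set X}
    (hconv : IsConvex M) (hgeod : IsGeodesicSpace X) (hcurv : IsBusemannNonpositivelyCurved X)
    (hcomp : IsCompact M) {γ : ℝ → X} (hγ : Isometry γ) (h0 : γ 0 ∈ M) {s : ℝ} (hs : 0 < s)
    (hinf : s ≤ Metric.infDist (γ s) M) (t : ℝ) : t ≤ Metric.infDist (γ t) M := by
  have pow : ∀ n : ℕ, 2 ^ n * s ≤ Metric.infDist (γ (2 ^ n * s)) M := by
    intro n
    induction n with
    | zero => simpa using hinf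
    | succ n ih =>
      have := hconv.two_mul_infDist_le hgeod hcurv hcomp hγ h0 (t := 2 ^ n * s) (by positivity)
      rw [pow_succ', mul_assoc]
      linarith
  -- Go back from a dyadic multiple of s beyond t: the distance to M is 1-Lipschitz, so it drops by
  -- at most the parameter difference.
  obtain ⟨n, hn⟩ := pow_unbounded_of_one_lt (t / s) one_lt_two
  have hn' : t < 2 ^ n * s := (div_lt_iff₀ hs).1 hn
  have h1 := pow n
  have h2 := Metric.infDist_le_infDist_add_dist (x := γ (2 ^ n * s)) (y := γ t) (s := M)
  rw [hγ.dist_eq, Real.dist_eq, abs_of_nonneg (by linarith)] at h2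
  linarith

/-- A ball centered outside of a compact convex set is a strictly worse approximation of that set
than some ball centered in the set. -/
theorem IsConvex.exists_hausdorffDist_closedBall_lt {X : Type*} [MetricSpace X] {M : Set X}
    (hconv : IsConvex M) (hgeod : IsGeodesicSpace X) (hline : HasUniqueLines X)
    (hcurv : IsBusemannNonpositivelyCurved X) (hne : M.Nonempty) (hcomp : IsCompact M)
    {x : X} (hx : x ∉ M) {r : ℝ} (hr : 0 ≤ r) :
    ∃ p ∈ M, ∃ t : ℝ, 0 ≤ t ∧ Metric.hausdorffDist M (Metric.closedBall p t)
      < Metric.hausdorffDist M (Metric.closedBall x r) := by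
  obtain ⟨p, hp, hxp⟩ := hcomp.exists_infDist_eq_dist hne x
  obtain ⟨m, hm, hmax⟩ :=
    hcomp.exists_isMaxOn hne (continuous_const.dist continuous_id : Continuous (dist p)).continuousOn
  have hpx : p ≠ x := fun h => hx (h ▸ hp)
  obtain ⟨γ, hγ, rfl, hγx⟩ := hline.exists_isometry hpx
  have hs : 0 < dist (γ 0) x := dist_pos.2 hpx
  have hfar := hconv.le_infDist_ray hgeod hcurv hcomp hγ hp hs
    (by rw [hγx, hxp, dist_comm]) (dist (γ 0) x + r)
  have hlt : dist (γ 0) m < dist (γ 0) x + dist x m :=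
    lt_of_le_of_ne (dist_triangle _ _ _)
      fun h => hx (hconv.mem_of_dist_add_dist_eq hgeod hp hm h.symm)
  have hfin := hausdorffEDist_closedBall_ne_top hne hcomp.isBounded x hr
  have hball : γ (dist (γ 0) x + r) ∈ Metric.closedBall x r := by
    have := hγ.dist_eq (dist (γ 0) x + r) (dist (γ 0) x)
    rw [hγx, Real.dist_eq, add_sub_cancel_left, abs_of_nonneg hr] at this
    exact this.le
  have lower1 : dist (γ 0) x + r ≤ Metric.hausdorffDist M (Metric.closedBall x r) := by
    rw [Metric.hausdorffDist_comm]
    rw [Metric.hausdorffEDist_comm] at hfin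
    exact hfar.trans (Metric.infDist_le_hausdorffDist_of_mem hball hfin)
  have lower2 : dist x m - r ≤ Metric.hausdorffDist M (Metric.closedBall x r) := by
    refine le_trans ?_ (Metric.infDist_le_hausdorffDist_of_mem hm hfin)
    refine (Metric.le_infDist (Metric.nonempty_closedBall.2 hr)).2 fun y hy => ?_
    have := Metric.mem_closedBall'.1 hy
    linarith [dist_triangle_right x m y]
  have hd : 0 ≤ dist (γ 0) m := dist_nonneg
  -- Points of M lie within |pm| of p, so half that radius balances the two one-sided errors.
  have upper : Metric.hausdorffDist M (Metric.closedBall (γ 0) (dist (γ 0) m / 2))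
      ≤ dist (γ 0) m / 2 := by
    refine Metric.hausdorffDist_le_of_mem_dist (by linarith) ?_ ?_
    · intro y hy
      obtain ⟨c, hc, hyc⟩ := hgeod.exists_mem_closedBall_dist_le (γ 0) y
        (t := dist (γ 0) m / 2) (by linarith)
      have := isMaxOn_iff.1 hmax y hy
      exact ⟨c, hc, hyc.trans (max_le (by linarith) (by linarith))⟩
    · exact fun b hb => ⟨γ 0, hp, hb⟩
  -- Adding `lower1` and `lower2` cancels r.
  exact ⟨γ 0, hp, dist (γ 0) m / 2, by linarith, by linarith⟩

/-! ### Existence of an optimal ball centered in M -/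

/-- Once the ball contains M, only its excess over M counts, and this grows with the radius. Hence
radii above diam M can be discarded. -/
theorem hausdorffDist_closedBall_le_of_subset {X : Type*} [MetricSpace X] {M : Set X}
    (hne : M.Nonempty) (hM : Bornology.IsBounded M) {x : X} {r t : ℝ} (hr : 0 ≤ r) (hrt : r ≤ t)
    (hsub : M ⊆ Metric.closedBall x r) :
    Metric.hausdorffDist M (Metric.closedBall x r)
      ≤ Metric.hausdorffDist M (Metric.closedBall x t) := by
  have hfin := hausdorffEDist_closedBall_ne_top hne hM x (hr.trans hrt)
  rw [Metric.hausdorffEDist_comm] at hfin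
  refine Metric.hausdorffDist_le_of_infDist Metric.hausdorffDist_nonneg ?_ ?_
  · intro y hy
    rw [Metric.infDist_zero_of_mem (hsub hy)]
    exact Metric.hausdorffDist_nonneg
  · intro b hb
    rw [Metric.hausdorffDist_comm]
    exact Metric.infDist_le_hausdorffDist_of_mem (Metric.closedBall_subset_closedBall hrt hb) hfin

theorem IsGeodesicSpace.continuousOn_hausdorffDist_closedBall {X : Type*} [MetricSpace X]
    (hgeod : IsGeodesicSpace X) {M : Set X} (hne : M.Nonempty) (hM : Bornology.IsBounded M) :
    ContinuousOn (fun z : X × ℝ => Metric.hausdorffDist M (Metric.closedBall z.1 z.2))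
      {z | 0 ≤ z.2} := by
  -- The constant is 2 because the product carries the sup metric: center and radius each contribute
  -- at most one `dist z w`.
  refine (LipschitzOnWith.of_le_add_mul 2 fun z hz w hw => ?_).continuousOn
  have h1 := Metric.hausdorffDist_triangle (u := Metric.closedBall z.1 z.2)
    (hausdorffEDist_closedBall_ne_top hne hM w.1 hw)
  have h2 := hgeod.hausdorffDist_closedBall_le w.1 z.1 hw hz
  have h3 : dist w.1 z.1 ≤ dist z w := by
    rw [dist_comm z w, Prod.dist_eq]; exact le_max_left _ _
  have h4 : |w.2 - z.2| ≤ dist z w := by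
    rw [dist_comm z w, Prod.dist_eq]; exact le_max_right _ _
  simp only [NNReal.coe_ofNat]
  linarith

theorem bddBelow_hausdorffDist_closedBall {X : Type*} [MetricSpace X] (M : Set X) :
    BddBelow {d : ℝ | ∃ (y : X) (t : ℝ), 0 ≤ t ∧
      d = Metric.hausdorffDist M (Metric.closedBall y t)} :=
  ⟨0, by rintro _ ⟨y, t, -, rfl⟩; exact Metric.hausdorffDist_nonneg⟩

/-- Among the balls centered in a compact set there is a best approximation of the set. -/
theorem IsGeodesicSpace.exists_best_closedBall {X : Type*} [MetricSpace X]
    (hgeod : IsGeodesicSpace X) {M : Set X} (hne : M.Nonempty) (hcomp : IsCompact M) :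
    ∃ x ∈ M, ∃ r : ℝ, 0 ≤ r ∧ ∀ y ∈ M, ∀ t : ℝ, 0 ≤ t →
      Metric.hausdorffDist M (Metric.closedBall x r)
        ≤ Metric.hausdorffDist M (Metric.closedBall y t) := by
  have hD : 0 ≤ Metric.diam M := Metric.diam_nonneg
  obtain ⟨⟨x, r⟩, ⟨hx, hr⟩, hmin⟩ :=
    (hcomp.prod (isCompact_Icc (a := 0) (b := Metric.diam M))).exists_isMinOn
      (hne.prod ⟨0, le_rfl, hD⟩)
      ((hgeod.continuousOn_hausdorffDist_closedBall hne hcomp.isBounded).mono fun z hz => hz.2.1)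
  refine ⟨x, hx, r, hr.1, fun y hy t ht => ?_⟩
  rcases le_total t (Metric.diam M) with h | h
  · exact isMinOn_iff.1 hmin (y, t) ⟨hy, ht, h⟩
  · exact (isMinOn_iff.1 hmin (y, Metric.diam M) ⟨hy, hD, le_rfl⟩).trans
      (hausdorffDist_closedBall_le_of_subset hne hcomp.isBounded hD h
        fun z hz => Metric.dist_le_diam_of_mem hcomp.isBounded hz hy)

end BallApprox

theorem theorem2p9p2 {X : Type*} [MetricSpace X]
    (hgeod : BallApprox.IsGeodesicSpace X)
    (hline : BallApprox.HasUniqueLines X)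
    (hcurv : BallApprox.IsBusemannNonpositivelyCurved X)
    (M : Set X) (hne : M.Nonempty) (hcomp : IsCompact M) (hconv : BallApprox.IsConvex M) :
    (BallApprox.bestBallCenters M).Nonempty ∧ BallApprox.bestBallCenters M ⊆ M := by
  have hbdd := BallApprox.bddBelow_hausdorffDist_closedBall M
  constructor
  · obtain ⟨x, hx, r, hr, hbest⟩ := hgeod.exists_best_closedBall hne hcomp
    refine ⟨x, r, hr, ?_⟩
    rw [Metric.hausdorffDist_comm]
    refine le_antisymm (le_csInf ⟨_, x, r, hr, rfl⟩ ?_) (csInf_le hbdd ⟨x, r, hr, rfl⟩)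
    rintro _ ⟨y, t, ht, rfl⟩
    by_cases hy : y ∈ M
    · exact hbest y hy t ht
    · obtain ⟨p, hp, u, hu, hlt⟩ :=
        hconv.exists_hausdorffDist_closedBall_lt hgeod hline hcurv hne hcomp hy ht
      exact (hbest p hp u hu).trans hlt.le
  · rintro x ⟨r, hr, hxr⟩
    by_contra hx
    obtain ⟨p, hp, u, hu, hlt⟩ :=
      hconv.exists_hausdorffDist_closedBall_lt hgeod hline hcurv hne hcomp hx hr
    rw [Metric.hausdorffDist_comm] at hxr
    exact (hlt.trans_le (hxr.le.trans (csInf_le hbdd ⟨p, u, hu, rfl⟩))).false
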